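/- Let $n\ge 1$, $m=2n$, and let $A=(a_{jk})$, $B=(b_{jk})$ be complex $m\times m$ matrices ($1\le j\le m$, $0\le k\le m-1$) such that the boundary forms $$U_j(y)=\sum_{k=0}^{m-1}\bigl(a_{jk}\,y^{(k)}(0)+b_{jk}\,y^{(k)}(1)\bigr),\qquad j=1,\dots,m,$$ are linearly independent. Let $L_0y=(-i)^m y^{(m)}$ be the operator in $L^2(0,1)$ with domain $$D(L_0)=\{y\in W_2^m[0,1]:\ U_j(y)=0,\ j=1,\dots,m\},$$ and suppose that $L_0$ is dissipative, that is, $\operatorname{Im}(L_0y,y)\ge 0$ for all $y\in D(L_0)$. Then the boundary conditions $U_j(y)=0$ are Birkhoff-regular, in the following sense. The conditions can be normalized: replacing them by $m$ linearly independent linear combinations of them, one can obtain equivalent conditions of the form $$\alpha_j y^{(k_j)}(0)+\beta_j y^{(k_j)}(1)+\sum_{s<k_j}\bigl(\alpha_{js}y^{(s)}(0)+\beta_{js}y^{(s)}(1)\bigr)=0,\qquad j=1,\dots,m,$$ with $m-1\ge k_1\ge k_2\ge\dots\ge k_m\ge 0$, where for each order $r$ the pairs $(\alpha_j,\beta_j)$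 with $k_j=r$ are linearly independent (so each pair is nonzero and $k_j>k_{j+2}$). Let $\omega_1,\dots,\omega_m$ be the $m$-th roots of $-1$, numbered so that $$\operatorname{Re}\bigl(\omega_1e^{i\pi/(2m)}\bigr)<\dots<\operatorname{Re}\bigl(\omega_me^{i\pi/(2m)}\bigr).$$ For every such normalized system, at least one of the numbers $\theta_{-1},\theta_1$ defined by $$\frac{\theta_{-1}}{s}+\theta_0+\theta_1s=\det\bigl(c_{jl}(s)\,\omega_l^{k_j}\bigr)_{j,l=1}^{m}\qquad(s\ne0)$$ is nonzero, where $c_{jl}(s)=\alpha_j$ for $l<n$, $c_{jn}(s)=\alpha_j+s\beta_j$, $c_{j,n+1}(s)=\alpha_j+\frac1s\beta_j$, and $c_{jl}(s)=\beta_j$ for $l>n+1$. -/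

import Mathlib

open Set MeasureTheory

/-- The space of square integrable functions with `m` derivatives on the unit interval (`m ≥ 1`), each
class being given by its continuous representative: `y` is `m - 1` times continuously
differentiable on `[0,1]`, the derivative of order `m - 1` is absolutely continuous on `[0,1]`,
and the derivative of order `m` (which then exists almost everywhere) is square integrable.
Only the values of `y` on `[0,1]` matter. -/
def MemSobolevTwo (m : ℕ) (y : ℝ → ℂ) : Prop :=
  ContDiffOn ℝ ((m - 1 : ℕ) : WithTop ℕ∞) y (Icc 0 1) ∧
  AbsolutelyContinuousOnInterval (iteratedDerivWithin (m - 1) y (Icc 0 1)) 0 1 ∧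
  MemLp (iteratedDerivWithin m y (Icc 0 1)) 2 (volume.restrict (Icc 0 1))

/-- The vector `(y(x), y'(x), …, y^(m-1)(x))` at a point `x` of `[0,1]`; at the end points the
derivatives are one-sided. -/
noncomputable def jet (m : ℕ) (y : ℝ → ℂ) (x : ℝ) : Fin m → ℂ :=
  fun k => iteratedDerivWithin (k : ℕ) y (Icc 0 1) x

/-- The boundary forms
`U_j(y) = ∑ k, (A j k * y^(k)(0) + B j k * y^(k)(1))`, `j = 1, …, m`. -/
noncomputable def boundaryForm {m : ℕ} (A B : Matrix (Fin m) (Fin m) ℂ) (j : Fin m)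
    (y : ℝ → ℂ) : ℂ :=
  ∑ k : Fin m, (A j k * jet m y 0 k + B j k * jet m y 1 k)

/-- The domain of `L₀`. -/
def operatorDomain {m : ℕ} (A B : Matrix (Fin m) (Fin m) ℂ) : Set (ℝ → ℂ) :=
  {y | MemSobolevTwo m y ∧ ∀ j, boundaryForm A B j y = 0}

/-- The differential expression `l₀(y) = (-i)^m y^(m)` on `[0,1]`. -/
noncomputable def diffExpr (m : ℕ) (y : ℝ → ℂ) (x : ℝ) : ℂ :=
  (-Complex.I) ^ m * iteratedDerivWithin m y (Icc 0 1) x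

/-- The inner product of `L²(0,1)`, linear in the first argument. -/
noncomputable def innerL2 (f g : ℝ → ℂ) : ℂ :=
  ∫ x in (0 : ℝ)..1, f x * (starRingEnd ℂ) (g x)

/-- The boundary conditions `U_j(y) = 0` are dissipative: `Im (L₀ y, y) ≥ 0` on the domain
of `L₀`. -/
def IsDissipativeBC {m : ℕ} (A B : Matrix (Fin m) (Fin m) ℂ) : Prop :=
  ∀ y ∈ operatorDomain A B, 0 ≤ (innerL2 (diffExpr m y) y).im

/-- The boundary forms with coefficients `(A, B)` are linearly independent, that is, the rows of
the `m × 2m` matrix `(A | B)` are. -/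
def IndependentBC {m : ℕ} (A B : Matrix (Fin m) (Fin m) ℂ) : Prop :=
  LinearIndependent ℂ (fun j : Fin m => (Sum.elim (A j) (B j) : Fin m ⊕ Fin m → ℂ))

/-- `(C, D)` arises from `(A, B)` by an invertible passage to linear combinations of the
boundary conditions. -/
def EquivalentBC {m : ℕ} (A B C D : Matrix (Fin m) (Fin m) ℂ) : Prop :=
  ∃ G : Matrix (Fin m) (Fin m) ℂ, IsUnit G ∧ C = G * A ∧ D = G * B

/-- The boundary conditions with coefficients `(C, D)` are normalized, with orders
`k_1 ≥ k_2 ≥ … ≥ k_m`. The `j`-th condition contains no derivative of order above `k_j`,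
and for every `r` the pairs `(α_j, β_j) = (C j r, D j r)` of leading coefficients of the
conditions of order `r` are linearly independent, so that no linear combination of these
conditions has smaller order. In particular each `(α_j, β_j)` is nonzero (hence
`k_j` is the order of the `j`-th condition), there are at most two conditions of each order,
and `k_j > k_{j+2}`. -/
structure IsNormalizedBC {m : ℕ} (C D : Matrix (Fin m) (Fin m) ℂ) (k : Fin m → Fin m) :
    Prop where
  antitone : Antitone k
  order_le : ∀ j s, k j < s → C j s = 0 ∧ D j s = 0
  leading : ∀ r : Fin m,
    LinearIndependent ℂ (fun j : {j : Fin m // k j = r} => ![C j r, D j r])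

/-- `ω_1, …, ω_m` are the `m`-th roots of `-1`, numbered so that
`Re (ω_1 e^{iπ/(2m)}) < … < Re (ω_m e^{iπ/(2m)})`. -/
def IsOrderedRoots (m : ℕ) (ω : Fin m → ℂ) : Prop :=
  (∀ j, ω j ^ m = -1) ∧
  StrictMono (fun j => (ω j * Complex.exp (Complex.I * Real.pi / (2 * m))).re)

/-- The numbering of the roots exists. It is unique: the condition forces the `m` numbers `ω_j` to
be distinct, and it fixes their order. -/
theorem exists_isOrderedRoots (m : ℕ) : ∃ ω : Fin m → ℂ, IsOrderedRoots m ω := by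
  rcases Nat.eq_zero_or_pos m with rfl | hm
  · exact ⟨fun _ => 0, fun j => j.elim0, fun j => j.elim0⟩
  have hm0 : (m : ℝ) ≠ 0 := by positivity
  have hmC : (m : ℂ) ≠ 0 := by exact_mod_cast hm.ne'
  set z : Fin m → ℂ := fun l =>
    Complex.exp (Complex.I * Real.pi * (2 * (l : ℕ) + 1) / m) with hz
  have hpow : ∀ l, z l ^ m = -1 := by
    intro l
    rw [hz]
    simp only
    rw [← Complex.exp_nat_mul]
    have : (m : ℂ) * (Complex.I * Real.pi * (2 * (l : ℕ) + 1) / m)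
        = ((l : ℕ) : ℂ) * (2 * Real.pi * Complex.I) + Real.pi * Complex.I := by
      field_simp
    rw [this, Complex.exp_add, Complex.exp_nat_mul_two_pi_mul_I, Complex.exp_pi_mul_I, one_mul]
  set f : Fin m → ℝ := fun l =>
    (z l * Complex.exp (Complex.I * Real.pi / (2 * m))).re with hf
  have hcos : ∀ l, f l = Real.cos (Real.pi * (4 * (l : ℕ) + 3) / (2 * m)) := by
    intro l
    rw [hf, hz]
    simp only
    rw [← Complex.exp_add]
    have : Complex.I * Real.pi * (2 * (l : ℕ) + 1) / m + Complex.I * Real.pi / (2 * m)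
        = ((Real.pi * (4 * (l : ℕ) + 3) / (2 * m) : ℝ) : ℂ) * Complex.I := by
      push_cast
      field_simp
      ring
    rw [this, Complex.exp_ofReal_mul_I_re]
  have hinj : Function.Injective f := by
    intro a b hab
    rw [hcos, hcos, Real.cos_eq_cos_iff] at hab
    obtain ⟨q, hq | hq⟩ := hab
    · have h1 : ((b : ℕ) : ℝ) = q * m + (a : ℕ) := by
        have hpi := Real.pi_ne_zero
        field_simp at hq
        linarith
      have h2 : ((b : ℕ) : ℤ) = q * m + (a : ℕ) := by exact_mod_cast h1
      have ha := a.2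
      have hb := b.2
      have hq0 : q = 0 := by
        by_contra hne
        rcases lt_or_gt_of_ne hne with h | h
        · nlinarith
        · nlinarith
      subst hq0
      apply Fin.ext
      simp at h2
      exact h2.symm
    · exfalso
      have h1 : (4 * ((b : ℕ) : ℝ) + 3) = 4 * (q * m) - (4 * (a : ℕ) + 3) := by
        have hpi := Real.pi_ne_zero
        field_simp at hq
        linarith
      have h2 : (4 * ((b : ℕ) : ℤ) + 3) = 4 * (q * m) - (4 * (a : ℕ) + 3) := by
        exact_mod_cast h1
      omega
  have hcard : (Finset.univ.image f).card = m := by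
    rw [Finset.card_image_of_injective _ hinj, Finset.card_univ, Fintype.card_fin]
  have hex : ∀ j : Fin m, ∃ l, f l = (Finset.univ.image f).orderEmbOfFin hcard j := by
    intro j
    have := Finset.orderEmbOfFin_mem (Finset.univ.image f) hcard j
    obtain ⟨l, _, h⟩ := Finset.mem_image.1 this
    exact ⟨l, h⟩
  choose σ hσ using hex
  refine ⟨fun j => z (σ j), fun j => hpow _, ?_⟩
  intro i j hij
  have h := ((Finset.univ.image f).orderEmbOfFin hcard).strictMono hij
  rw [← hσ, ← hσ] at h
  exact h

/-- The matrix whose determinant defines regularity in the even case `m = 2 n`. With the columns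
numbered `l = 1, …, 2n`, the entry in row `j` and column `l` is
`c * ω_l ^ k_j`, where `c = α_j` for `l < n`, `c = α_j + s β_j` for `l = n`,
`c = α_j + β_j / s` for `l = n + 1`, and `c = β_j` for `l > n + 1`. In the code the columns are
numbered from `0`. -/
noncomputable def regularityMatrix (n : ℕ) (α β : Fin (2 * n) → ℂ)
    (k : Fin (2 * n) → Fin (2 * n)) (ω : Fin (2 * n) → ℂ) (s : ℂ) :
    Matrix (Fin (2 * n)) (Fin (2 * n)) ℂ :=
  Matrix.of fun j l =>
    (if (l : ℕ) + 1 < n then α j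
     else if (l : ℕ) + 1 = n then α j + s * β j
     else if (l : ℕ) = n then α j + 1 / s * β j
     else β j) * ω l ^ (k j : ℕ)

/-- Regularity of normalized boundary conditions of even order `2 n`: in
`θ₋₁ / s + θ₀ + θ₁ s = det (regularityMatrix …)`, at least one of `θ₋₁`, `θ₁` is not zero. -/
def IsRegularNormalizedBC (n : ℕ) (C D : Matrix (Fin (2 * n)) (Fin (2 * n)) ℂ)
    (k : Fin (2 * n) → Fin (2 * n)) (ω : Fin (2 * n) → ℂ) : Prop :=
  ∃ θneg θzero θpos : ℂ,
    (∀ s : ℂ, s ≠ 0 →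
      θneg / s + θzero + θpos * s =
        (regularityMatrix n (fun j => C j (k j)) (fun j => D j (k j)) k ω s).det) ∧
    (θneg ≠ 0 ∨ θpos ≠ 0)

/-- Birkhoff regularity of boundary conditions of even order `2 n`: they can be normalized, and
however this is done, the normalized conditions are regular. The numbering `ω` of the roots
exists and is unique (`exists_isOrderedRoots` below). -/
def IsBirkhoffRegularBC (n : ℕ) (A B : Matrix (Fin (2 * n)) (Fin (2 * n)) ℂ) : Prop :=
  (∃ C D k, EquivalentBC A B C D ∧ IsNormalizedBC C D k) ∧
  ∀ C D k, EquivalentBC A B C D → IsNormalizedBC C D k →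
    ∀ ω, IsOrderedRoots (2 * n) ω → IsRegularNormalizedBC n C D k ω

/-! ### Smooth functions with prescribed jets at the end points -/

/-! By Lagrange's identity `Im (L₀ y, y)` is `(-1)^n / 2` times the difference between the end
points `1` and `0` of `Im (concomitant)` of the jet. Smooth functions attain all pairs of jets, so
dissipativity makes this boundary form nonnegative on the finite-dimensional kernel of the boundary
conditions (`IsDissipativeBC.concomitant_nonneg`).

Replace the conditions by normalized ones and rescale `x ↦ t x`. The form only picks up a positive
factor, so letting `t → 0` gives nonnegativity on the kernel of the principal parts
(`IsNormalizedBC.principal_nonneg`). Each principal condition involves a single order of derivative,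
hence that kernel is invariant under changing the sign of all derivatives of order at least `n`.
This change negates the form, which must therefore vanish there (`IsNormalizedBC.principal_eq`).

If `θ₋₁ = 0`, a null vector of its determinant yields a sum of decaying exponentials and a sum of
growing ones, with exponents `ζ ^ m = -i`, whose jets at `0`, used as data at `0` and at `1`,
satisfy the principal conditions. The form on these data is `-2` times the sum of the squared `L²`
norms of the two sums over the half-lines on which they decay (`concomitant_exponential_sum`,
`cauchyForm_nonneg_and_eq_zero`). So both sums vanish, a contradiction. Thus always `θ₋₁ ≠ 0`. -/

theorem iteratedDeriv_eval_ofReal (p : Polynomial ℂ) (k : ℕ) :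
    iteratedDeriv k (fun x : ℝ => p.eval (x : ℂ)) =
      fun x : ℝ => (Polynomial.derivative^[k] p).eval (x : ℂ) := by
  induction k generalizing p with
  | zero => simp
  | succ k ih =>
    have h : deriv (fun x : ℝ => p.eval (x : ℂ)) = fun x : ℝ => p.derivative.eval (x : ℂ) :=
      funext fun x => (p.hasDerivAt (x : ℂ)).comp_ofReal.deriv
    rw [iteratedDeriv_succ', h, ih, Function.iterate_succ_apply]

open scoped ContDiff in
theorem exists_contDiff_jet_zero {m : ℕ} (u : Fin m → ℂ) :
    ∃ f : ℝ → ℂ, ContDiff ℝ ∞ f ∧ ∀ k : Fin m, iteratedDeriv k f 0 = u k := by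
  let p : Polynomial ℂ := ∑ k : Fin m, Polynomial.monomial (k : ℕ) (u k / (k : ℕ).factorial)
  refine ⟨fun x => p.eval (x : ℂ), ?_, fun k => ?_⟩
  · have h : ContDiff ℝ ∞ (fun z : ℂ => p.eval z) := by
      simpa using (Polynomial.contDiff_aeval (𝕜 := ℂ) p ∞).restrict_scalars ℝ
    exact h.comp Complex.ofRealCLM.contDiff
  · rw [iteratedDeriv_eval_ofReal]
    simp only [Complex.ofReal_zero, ← Polynomial.coeff_zero_eq_eval_zero]
    rw [Polynomial.coeff_iterate_derivative, zero_add, Nat.descFactorial_self]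
    have h : p.coeff (k : ℕ) = u k / (k : ℕ).factorial := by
      simp only [p, Polynomial.finsetSum_coeff, Polynomial.coeff_monomial]
      rw [Finset.sum_eq_single k]
      · simp
      · intro b _ hb
        rw [if_neg (fun h => hb (Fin.ext h))]
      · simp
    rw [h, nsmul_eq_mul, mul_div_cancel₀]
    exact_mod_cast (Nat.factorial_ne_zero _)

-- Two polynomials with the required jets are glued by a smooth cut-off that is constant near each
-- end point.
open scoped ContDiff in
theorem exists_contDiff_jets {m : ℕ} (u w : Fin m → ℂ) :
    ∃ f : ℝ → ℂ, ContDiff ℝ ∞ f ∧ (∀ k : Fin m, iteratedDeriv k f 0 = u k) ∧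
      ∀ k : Fin m, iteratedDeriv k f 1 = w k := by
  obtain ⟨f, hf, hfu⟩ := exists_contDiff_jet_zero u
  obtain ⟨g, hg, hgw⟩ := exists_contDiff_jet_zero w
  -- `φ` is `0` for `x ≤ 1/3` and `1` for `x ≥ 2/3`.
  let φ : ℝ → ℝ := fun x => Real.smoothTransition (3 * x - 1)
  have hφ : ContDiff ℝ ∞ φ :=
    Real.smoothTransition.contDiff.comp ((contDiff_const.mul contDiff_id).sub contDiff_const)
  have hg' : ContDiff ℝ ∞ fun x => g (x - 1) := hg.comp (contDiff_id.sub contDiff_const)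
  refine ⟨fun x => f x + φ x • (g (x - 1) - f x), hf.add (hφ.smul (hg'.sub hf)), fun k => ?_,
    fun k => ?_⟩
  · rw [← hfu k]
    apply Filter.EventuallyEq.iteratedDeriv_eq
    filter_upwards [Iio_mem_nhds (show (0 : ℝ) < 1 / 3 by norm_num)] with x hx
    have : φ x = 0 := Real.smoothTransition.zero_of_nonpos (by
      have : x < 1 / 3 := hx
      linarith)
    simp [this]
  · have h1 : iteratedDeriv k (fun x => g (x - 1)) 1 = w k := by
      simp [iteratedDeriv_comp_sub_const, hgw]
    rw [← h1]
    apply Filter.EventuallyEq.iteratedDeriv_eq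
    filter_upwards [Ioi_mem_nhds (show (2 / 3 : ℝ) < 1 by norm_num)] with x hx
    have : φ x = 1 := Real.smoothTransition.one_of_one_le (by
      have : 2 / 3 < x := hx
      linarith)
    simp [this]

/-! ### The Lagrange identity -/

/-- The bilinear concomitant `∑ j, (-1)^j v_(m-1-j) * conj v_j` of the differential expression
`y^(m)`, as a function of the jet of `y` at a point. -/
noncomputable def concomitant {m : ℕ} (v : Fin m → ℂ) : ℂ :=
  ∑ j : Fin m, (-1) ^ (j : ℕ) * v j.rev * (starRingEnd ℂ) (v j)

open scoped ContDiff in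
theorem hasDerivAt_iteratedDeriv {y : ℝ → ℂ} (hy : ContDiff ℝ ∞ y) (k : ℕ) (x : ℝ) :
    HasDerivAt (iteratedDeriv k y) (iteratedDeriv (k + 1) y x) x := by
  rw [iteratedDeriv_succ]
  exact ((hy.differentiable_iteratedDeriv k (by exact_mod_cast WithTop.coe_lt_top _)) x).hasDerivAt

-- The product rule turns the alternating sum into a telescoping one; only the two extreme terms
-- survive.
open scoped ContDiff in
theorem hasDerivAt_concomitant {m : ℕ} {y : ℝ → ℂ} (hy : ContDiff ℝ ∞ y) (x : ℝ) :
    HasDerivAt (fun x => concomitant fun k : Fin m => iteratedDeriv k y x)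
      (iteratedDeriv m y x * (starRingEnd ℂ) (y x) -
        (-1) ^ m * (y x * (starRingEnd ℂ) (iteratedDeriv m y x))) x := by
  let a : ℕ → ℂ := fun j =>
    (-1) ^ j * iteratedDeriv (m - j) y x * (starRingEnd ℂ) (iteratedDeriv j y x)
  have key : ∀ j : Fin m, HasDerivAt
      (fun x => (-1) ^ (j : ℕ) * iteratedDeriv (j.rev : ℕ) y x *
        (starRingEnd ℂ) (iteratedDeriv (j : ℕ) y x)) (a j - a (j + 1)) x := by
    intro j
    have h1 := (hasDerivAt_iteratedDeriv hy (j.rev : ℕ) x).const_mul ((-1 : ℂ) ^ (j : ℕ))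
    have h2 := (hasDerivAt_iteratedDeriv hy (j : ℕ) x).star
    refine (h1.mul h2).congr_deriv ?_
    have hr : (j.rev : ℕ) = m - (j + 1) := Fin.val_rev j
    have hr' : m - (j + 1) + 1 = m - j := by omega
    simp only [a, hr, hr', pow_succ, starRingEnd_apply]
    ring
  have h := HasDerivAt.fun_sum (u := Finset.univ) fun j _ => key j
  rw [Fin.sum_univ_eq_sum_range (fun j => a j - a (j + 1)), Finset.sum_range_sub'] at h
  refine HasDerivAt.congr_deriv h ?_
  simp [a, mul_assoc]

open scoped ContDiff in
theorem integral_lagrange {m : ℕ} (hm : Even m) {y : ℝ → ℂ} (hy : ContDiff ℝ ∞ y) :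
    (concomitant fun k : Fin m => iteratedDeriv k y 1).im -
      (concomitant fun k : Fin m => iteratedDeriv k y 0).im =
      2 * (∫ x in (0 : ℝ)..1, iteratedDeriv m y x * (starRingEnd ℂ) (y x)).im := by
  have hc : Continuous (iteratedDeriv m y) := hy.continuous_iteratedDeriv m (by
    exact_mod_cast le_top)
  have hi : IntervalIntegrable (fun x => iteratedDeriv m y x * (starRingEnd ℂ) (y x)) volume 0 1 :=
    (hc.mul (Complex.continuous_conj.comp hy.continuous)).intervalIntegrable _ _
  have hi' : IntervalIntegrable (fun x => y x * (starRingEnd ℂ) (iteratedDeriv m y x)) volume 0 1 :=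
    (hy.continuous.mul (Complex.continuous_conj.comp hc)).intervalIntegrable _ _
  have h := intervalIntegral.integral_eq_sub_of_hasDerivAt (a := 0) (b := 1)
    (fun x _ => hasDerivAt_concomitant (m := m) hy x) (by
      simpa [hm.neg_one_pow] using hi.sub hi')
  rw [← Complex.sub_im, ← h]
  simp only [hm.neg_one_pow, one_mul]
  rw [intervalIntegral.integral_sub hi hi']
  have : ∫ x in (0 : ℝ)..1, y x * (starRingEnd ℂ) (iteratedDeriv m y x) =
      (starRingEnd ℂ) (∫ x in (0 : ℝ)..1, iteratedDeriv m y x * (starRingEnd ℂ) (y x)) := by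
    rw [← intervalIntegral.intervalIntegral_conj]
    simp [mul_comm]
  rw [this, Complex.sub_im, Complex.conj_im]
  ring

open scoped ContDiff in
theorem memSobolevTwo_of_contDiff {m : ℕ} {y : ℝ → ℂ} (hy : ContDiff ℝ ∞ y) :
    MemSobolevTwo m y := by
  have hd : UniqueDiffOn ℝ (Icc (0 : ℝ) 1) := uniqueDiffOn_Icc zero_lt_one
  have hle : ∀ k : ℕ, ((k : ℕ∞) : WithTop ℕ∞) ≤ ∞ := fun k => by exact_mod_cast le_top
  have heq : ∀ k, EqOn (iteratedDerivWithin k y (Icc 0 1)) (iteratedDeriv k y) (Icc 0 1) :=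
    fun k x hx => iteratedDerivWithin_eq_iteratedDeriv hd (hy.of_le (hle k)).contDiffAt hx
  refine ⟨(hy.of_le (hle _)).contDiffOn, ?_, ?_⟩
  · apply ContDiffOn.absolutelyContinuousOnInterval
    rw [uIcc_of_le zero_le_one]
    exact (ContDiff.contDiffOn (by
      rw [iteratedDeriv_eq_iterate]
      exact ContDiff.iterate_deriv' 1 (m - 1) (hy.of_le (hle (1 + (m - 1)))))).congr (heq _)
  · have hc : Continuous (iteratedDeriv m y) := hy.continuous_iteratedDeriv m (hle m)
    obtain ⟨K, hK⟩ := isCompact_Icc.exists_bound_of_continuousOn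
      (hc.continuousOn (s := Icc (0 : ℝ) 1))
    have hae : iteratedDeriv m y =ᵐ[volume.restrict (Icc 0 1)]
        iteratedDerivWithin m y (Icc 0 1) :=
      (ae_restrict_mem measurableSet_Icc).mono fun x hx => (heq m hx).symm
    exact (MemLp.of_bound hc.aestronglyMeasurable K
      ((ae_restrict_mem measurableSet_Icc).mono hK)).ae_eq hae

open scoped ContDiff in
/-- On the kernel of the boundary forms, the boundary form of the Lagrange identity is
nonnegative. -/
theorem IsDissipativeBC.concomitant_nonneg {n : ℕ} {A B : Matrix (Fin (2 * n)) (Fin (2 * n)) ℂ}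
    (hdiss : IsDissipativeBC A B) (u w : Fin (2 * n) → ℂ)
    (h : A.mulVec u + B.mulVec w = 0) :
    0 ≤ (-1) ^ n * ((concomitant w).im - (concomitant u).im) := by
  obtain ⟨y, hy, hu, hw⟩ := exists_contDiff_jets u w
  have hd : UniqueDiffOn ℝ (Icc (0 : ℝ) 1) := uniqueDiffOn_Icc zero_lt_one
  have heq : ∀ k, EqOn (iteratedDerivWithin k y (Icc 0 1)) (iteratedDeriv k y) (Icc 0 1) :=
    fun k x hx => iteratedDerivWithin_eq_iteratedDeriv hd
      (hy.of_le (by exact_mod_cast le_top)).contDiffAt hx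
  have h0 : jet (2 * n) y 0 = u := funext fun k => (heq k (by simp)).trans (hu k)
  have h1 : jet (2 * n) y 1 = w := funext fun k => (heq k (by simp)).trans (hw k)
  have hdom : y ∈ operatorDomain A B := by
    refine ⟨memSobolevTwo_of_contDiff hy, fun j => ?_⟩
    have := congrFun h j
    simpa [boundaryForm, h0, h1, Finset.sum_add_distrib, Matrix.mulVec, dotProduct] using this
  have hpos := hdiss y hdom
  have hL := integral_lagrange (even_two_mul n) hy
  simp only [hu, hw] at hL
  rw [hL]
  have hI : innerL2 (diffExpr (2 * n) y) y = (((-1 : ℝ) ^ n : ℝ) : ℂ) *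
      ∫ x in (0 : ℝ)..1, iteratedDeriv (2 * n) y x * (starRingEnd ℂ) (y x) := by
    rw [innerL2, ← intervalIntegral.integral_const_mul]
    apply intervalIntegral.integral_congr
    intro x hx
    rw [uIcc_of_le zero_le_one] at hx
    -- Here `(-i)^(2n) = (-1)^n` is real, so it passes through the imaginary part.
    simp only [diffExpr, heq (2 * n) hx, pow_mul]
    simp [mul_assoc]
  rw [hI, Complex.im_ofReal_mul] at hpos
  linarith

/-! ### Positivity of the Cauchy kernel -/

/-- The quadratic form with matrix `-1 / (ζ_i + conj ζ_j)`. -/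
noncomputable def cauchyForm {m : ℕ} (ζ c : Fin m → ℂ) : ℂ :=
  ∑ i, ∑ j, c i * (starRingEnd ℂ) (c j) / -(ζ i + (starRingEnd ℂ) (ζ j))

theorem hasDerivAt_exp_mul_ofReal (z : ℂ) (x : ℝ) :
    HasDerivAt (fun x : ℝ => Complex.exp (z * x)) (z * Complex.exp (z * x)) x := by
  have h := ((hasDerivAt_id (x : ℂ)).const_mul z).cexp.comp_ofReal
  refine h.congr_deriv ?_
  simp [mul_comm]

theorem tendsto_exp_mul_ofReal_atTop {z : ℂ} (hz : z.re < 0) :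
    Filter.Tendsto (fun x : ℝ => Complex.exp (z * x)) Filter.atTop (nhds 0) := by
  rw [tendsto_zero_iff_norm_tendsto_zero]
  simp only [Complex.norm_exp, Complex.re_mul_ofReal]
  exact Real.tendsto_exp_atBot.comp (Filter.tendsto_id.const_mul_atTop_of_neg hz)

/-- Differentiating `s` times at `x = 1` shows that the numbers `c_i e^{ζ_i}` annihilate all powers
`ζ_i ^ s`; the Vandermonde argument then applies. -/
theorem eq_zero_of_sum_exp_eq_zero {m : ℕ} {ζ c : Fin m → ℂ} (hζ : Function.Injective ζ)
    (h : ∀ x : ℝ, 0 < x → ∑ i, c i * Complex.exp (ζ i * x) = 0) : c = 0 := by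
  have key : ∀ s : ℕ, ∀ x : ℝ, 0 < x → ∑ i, c i * ζ i ^ s * Complex.exp (ζ i * x) = 0 := by
    intro s
    induction s with
    | zero => simpa using h
    | succ s ih =>
      intro x hx
      have h1 : HasDerivAt (fun x : ℝ => ∑ i, c i * ζ i ^ s * Complex.exp (ζ i * x))
          (∑ i, c i * ζ i ^ s * (ζ i * Complex.exp (ζ i * x))) x :=
        HasDerivAt.fun_sum fun i _ => (hasDerivAt_exp_mul_ofReal (ζ i) x).const_mul _
      have h2 : HasDerivAt (fun x : ℝ => ∑ i, c i * ζ i ^ s * Complex.exp (ζ i * x)) 0 x :=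
        (hasDerivAt_const x (0 : ℂ)).congr_of_eventuallyEq (by
          filter_upwards [Ioi_mem_nhds hx] with t ht using ih t ht)
      rw [← h1.unique h2]
      exact Finset.sum_congr rfl fun i _ => by ring
  have h0 : (fun i => c i * Complex.exp (ζ i * (1 : ℝ))) = 0 :=
    Matrix.eq_zero_of_forall_pow_sum_mul_pow_eq_zero hζ fun s => by
      rw [← key s 1 one_pos]
      exact Finset.sum_congr rfl fun i _ => by ring
  funext i
  simpa using congrFun h0 i

/-- With `y(x) = ∑ c_i e^{ζ_i x}` the form equals `∫₀^∞ |y|²`. The improper integral is avoided by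
using the tail `F`: it has derivative `-|y|²` and tends to `0`. The sign of `Re ζ_i` is required
only where `c_i ≠ 0`, so that one family `ζ` can serve for both the decaying and the growing
exponentials. -/
theorem cauchyForm_nonneg_and_eq_zero {m : ℕ} {ζ c : Fin m → ℂ} (hζ : Function.Injective ζ)
    (hre : ∀ i, c i ≠ 0 → (ζ i).re < 0) :
    0 ≤ (cauchyForm ζ c).re ∧ ((cauchyForm ζ c).re = 0 → c = 0) := by
  let y : ℝ → ℂ := fun x => ∑ i, c i * Complex.exp (ζ i * x)
  let F : ℝ → ℂ := fun x => cauchyForm ζ fun i => c i * Complex.exp (ζ i * x)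
  have hF : F = fun x : ℝ => ∑ i, ∑ j, c i * (starRingEnd ℂ) (c j) /
      -(ζ i + (starRingEnd ℂ) (ζ j)) * Complex.exp ((ζ i + (starRingEnd ℂ) (ζ j)) * x) := by
    funext x
    refine Finset.sum_congr rfl fun i _ => Finset.sum_congr rfl fun j _ => ?_
    rw [map_mul, ← Complex.exp_conj, map_mul, Complex.conj_ofReal, add_mul, Complex.exp_add]
    ring
  have hneg : ∀ i j, c i ≠ 0 → c j ≠ 0 → (ζ i + (starRingEnd ℂ) (ζ j)).re < 0 := by
    intro i j hi hj
    rw [Complex.add_re, Complex.conj_re]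
    exact add_neg (hre i hi) (hre j hj)
  have hF0 : F 0 = cauchyForm ζ c := by simp [F]
  have hlim : Filter.Tendsto F Filter.atTop (nhds 0) := by
    rw [hF, show (0 : ℂ) = ∑ _i : Fin m, ∑ _j : Fin m, 0 by simp]
    refine tendsto_finsetSum _ fun i _ => tendsto_finsetSum _ fun j _ => ?_
    by_cases hi : c i = 0
    · simp [hi]
    by_cases hj : c j = 0
    · simp [hj]
    simpa using (tendsto_exp_mul_ofReal_atTop (hneg i j hi hj)).const_mul
      (c i * (starRingEnd ℂ) (c j) / -(ζ i + (starRingEnd ℂ) (ζ j)))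
  have hder : ∀ x, HasDerivAt F (-((Complex.normSq (y x) : ℝ) : ℂ)) x := by
    intro x
    rw [hF]
    have h := HasDerivAt.fun_sum (u := Finset.univ) fun i _ =>
      HasDerivAt.fun_sum (u := Finset.univ) fun j _ =>
        (hasDerivAt_exp_mul_ofReal (ζ i + (starRingEnd ℂ) (ζ j)) x).const_mul
          (c i * (starRingEnd ℂ) (c j) / -(ζ i + (starRingEnd ℂ) (ζ j)))
    refine h.congr_deriv ?_
    rw [← Complex.mul_conj, map_sum, Finset.sum_mul_sum, ← Finset.sum_neg_distrib]
    refine Finset.sum_congr rfl fun i _ => ?_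
    rw [← Finset.sum_neg_distrib]
    refine Finset.sum_congr rfl fun j _ => ?_
    by_cases hi : c i = 0
    · simp [hi]
    by_cases hj : c j = 0
    · simp [hj]
    have hne : ζ i + (starRingEnd ℂ) (ζ j) ≠ 0 := fun h0 => by
      have := hneg i j hi hj
      simp [h0] at this
    have he : Complex.exp ((ζ i + (starRingEnd ℂ) (ζ j)) * x) =
        Complex.exp (ζ i * x) * Complex.exp ((starRingEnd ℂ) (ζ j) * x) := by
      rw [add_mul, Complex.exp_add]
    rw [map_mul, ← Complex.exp_conj, map_mul, Complex.conj_ofReal, he]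
    field_simp
  have hder' : ∀ x, HasDerivAt (fun x => (F x).re) (-Complex.normSq (y x)) x := by
    intro x
    exact (Complex.reCLM.hasFDerivAt.comp_hasDerivAt x (hder x)).congr_deriv (by simp)
  have hanti : Antitone fun x => (F x).re :=
    antitone_of_deriv_nonpos (fun x => (hder' x).differentiableAt) fun x => by
      rw [(hder' x).deriv]
      exact neg_nonpos.2 (Complex.normSq_nonneg _)
  have hlim' : Filter.Tendsto (fun x => (F x).re) Filter.atTop (nhds 0) := by
    exact (Complex.continuous_re.tendsto 0).comp hlim
  have hnn : ∀ x, 0 ≤ (F x).re := fun x => hanti.le_of_tendsto hlim' x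
  refine ⟨hF0 ▸ hnn 0, fun h0 => eq_zero_of_sum_exp_eq_zero hζ fun x hx => ?_⟩
  have hz : ∀ t, 0 ≤ t → (F t).re = 0 := fun t ht =>
    le_antisymm ((hanti ht).trans_eq (by simpa [hF0] using h0)) (hnn t)
  have h2 : HasDerivAt (fun x => (F x).re) 0 x :=
    (hasDerivAt_const x (0 : ℝ)).congr_of_eventuallyEq (by
      filter_upwards [Ioi_mem_nhds hx] with t ht using hz t (le_of_lt ht))
  have h3 := (hder' x).unique h2
  exact Complex.normSq_eq_zero.1 (neg_eq_zero.1 h3)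

/-- The concomitant of the jet at `0` of an exponential sum whose exponents satisfy
`ζ ^ m = -i`. -/
theorem concomitant_exponential_sum {m : ℕ} (hm : Even m) {ζ c : Fin m → ℂ}
    (hζ : ∀ i, ζ i ^ m = -Complex.I)
    (hne : ∀ i j, c i ≠ 0 → c j ≠ 0 → ζ i + (starRingEnd ℂ) (ζ j) ≠ 0) :
    concomitant (fun s : Fin m => ∑ i, c i * ζ i ^ (s : ℕ)) =
      2 * Complex.I * cauchyForm ζ c := by
  have hgeom : ∀ i j, (∑ s : Fin m, (-1) ^ (s : ℕ) * ζ i ^ (s.rev : ℕ) *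
      (starRingEnd ℂ) (ζ j) ^ (s : ℕ)) * (ζ i + (starRingEnd ℂ) (ζ j)) = -(2 * Complex.I) := by
    intro i j
    -- The sum over `s` is geometric. As `m` is even, its closed form has numerator `conj (ζ_j ^ m)
    -- - ζ_i ^ m = 2i`.
    have h := geom_sum₂_mul (-(starRingEnd ℂ) (ζ j)) (ζ i) m
    rw [hm.neg_pow, ← map_pow, hζ, hζ] at h
    have h' : (∑ s : Fin m, (-1) ^ (s : ℕ) * ζ i ^ (s.rev : ℕ) *
        (starRingEnd ℂ) (ζ j) ^ (s : ℕ)) =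
        ∑ s ∈ Finset.range m, (-(starRingEnd ℂ) (ζ j)) ^ s * ζ i ^ (m - 1 - s) := by
      rw [← Fin.sum_univ_eq_sum_range
        (fun s => (-(starRingEnd ℂ) (ζ j)) ^ s * ζ i ^ (m - 1 - s))]
      refine Finset.sum_congr rfl fun s _ => ?_
      rw [Fin.val_rev, neg_pow (R := ℂ), show m - ((s : ℕ) + 1) = m - 1 - s by omega]
      ring
    rw [h']
    simp only [map_neg, Complex.conj_I] at h
    linear_combination -h
  have hexp : concomitant (fun s : Fin m => ∑ i, c i * ζ i ^ (s : ℕ)) =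
      ∑ i, ∑ j, c i * (starRingEnd ℂ) (c j) * ∑ s : Fin m, (-1) ^ (s : ℕ) *
        ζ i ^ (s.rev : ℕ) * (starRingEnd ℂ) (ζ j) ^ (s : ℕ) := by
    simp only [concomitant, map_sum, map_mul, map_pow, Finset.mul_sum, Finset.sum_mul]
    rw [Finset.sum_comm]
    conv_rhs => rw [Finset.sum_comm]
    refine Finset.sum_congr rfl fun i _ => ?_
    rw [Finset.sum_comm]
    exact Finset.sum_congr rfl fun j _ => Finset.sum_congr rfl fun s _ => by ring
  rw [hexp, cauchyForm, Finset.mul_sum]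
  refine Finset.sum_congr rfl fun i _ => ?_
  rw [Finset.mul_sum]
  refine Finset.sum_congr rfl fun j _ => ?_
  by_cases hi : c i = 0
  · simp [hi]
  by_cases hj : c j = 0
  · simp [hj]
  have h0 := hne i j hi hj
  rw [eq_div_of_mul_eq h0 (hgeom i j)]
  field_simp

theorem cauchyForm_neg {m : ℕ} (ζ c : Fin m → ℂ) : cauchyForm (-ζ) c = -cauchyForm ζ c := by
  simp only [cauchyForm, ← Finset.sum_neg_distrib, Pi.neg_apply, map_neg]
  refine Finset.sum_congr rfl fun i _ => Finset.sum_congr rfl fun j _ => ?_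
  rw [← neg_add, div_neg]

/-- If the jets at `0` of a sum of decaying exponentials and of a sum of growing exponentials
(with exponents `ζ ^ m = -i`) have the same concomitant, both sums are zero. -/
theorem eq_zero_of_concomitant_im_eq {m : ℕ} (hm : Even m) {ζ c d : Fin m → ℂ}
    (hinj : Function.Injective ζ) (hζ : ∀ i, ζ i ^ m = -Complex.I)
    (hc : ∀ i, c i ≠ 0 → (ζ i).re < 0) (hd : ∀ i, d i ≠ 0 → 0 < (ζ i).re)
    (h : (concomitant fun s : Fin m => ∑ i, d i * ζ i ^ (s : ℕ)).im =
      (concomitant fun s : Fin m => ∑ i, c i * ζ i ^ (s : ℕ)).im) : c = 0 ∧ d = 0 := by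
  have h1 := cauchyForm_nonneg_and_eq_zero hinj hc
  -- Reflection makes the growing exponentials decay and negates the form. Hence the two
  -- concomitants have imaginary parts of opposite sign, and equality forces both to be zero.
  have h2 := cauchyForm_nonneg_and_eq_zero (ζ := -ζ) (c := d) (neg_injective.comp hinj)
    fun i hi => by simpa using hd i hi
  rw [concomitant_exponential_sum hm hζ fun i j hi hj h0 => ?_,
    concomitant_exponential_sum hm hζ fun i j hi hj h0 => ?_] at h
  · rw [cauchyForm_neg, Complex.neg_re] at h2
    simp at h
    exact ⟨h1.2 (by linarith [h1.1, h2.1]), h2.2 (by linarith [h1.1, h2.1])⟩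
  · have := congrArg Complex.re h0
    simp at this
    linarith [hc i hi, hc j hj]
  · have := congrArg Complex.re h0
    simp at this
    linarith [hd i hi, hd j hj]

/-! ### Passage to the principal parts of the boundary conditions -/

/-- The concomitant pairs the orders `s` and `m - 1 - s`, whose weights multiply to `t ^ (m - 1)`.
-/
theorem concomitant_smul_rev {m : ℕ} (t : ℝ) (v : Fin m → ℂ) :
    concomitant (fun s => (t : ℂ) ^ (s.rev : ℕ) * v s) =
      ((t ^ (m - 1) : ℝ) : ℂ) * concomitant v := by
  rw [concomitant, concomitant, Finset.mul_sum]
  refine Finset.sum_congr rfl fun s _ => ?_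
  have h : m - 1 = (s : ℕ) + (s.rev : ℕ) := by
    rw [Fin.val_rev]
    omega
  rw [h, Fin.rev_rev, map_mul, map_pow, Complex.conj_ofReal, Complex.ofReal_pow, pow_add]
  ring

/-- Of two paired orders `s` and `2n - 1 - s` exactly one is below `n`, so every term changes sign.
-/
theorem concomitant_flip {n : ℕ} (v : Fin (2 * n) → ℂ) :
    concomitant (fun s => (if (s : ℕ) < n then 1 else -1) * v s) = -concomitant v := by
  rw [concomitant, concomitant, ← Finset.sum_neg_distrib]
  refine Finset.sum_congr rfl fun s _ => ?_
  have hr := Fin.val_rev s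
  by_cases h : (s : ℕ) < n
  · rw [if_pos h, if_neg (by omega)]
    simp
  · rw [if_neg h, if_pos (by omega)]
    simp

theorem continuous_concomitant {m : ℕ} : Continuous (concomitant (m := m)) := by
  unfold concomitant
  fun_prop

/-- The matrix of the boundary conditions after the change of variables `x ↦ t x`; for `t = 0` the
principal parts of the conditions are left. -/
noncomputable def scaledBC {m : ℕ} (C D : Matrix (Fin m) (Fin m) ℂ) (k : Fin m → Fin m) (t : ℝ) :
    Matrix (Fin m) (Fin m ⊕ Fin m) ℂ :=
  Matrix.of fun j => Sum.elim (fun s => (t : ℂ) ^ ((k j : ℕ) - (s : ℕ)) * C j s)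
    (fun s => (t : ℂ) ^ ((k j : ℕ) - (s : ℕ)) * D j s)

theorem continuous_scaledBC {m : ℕ} (C D : Matrix (Fin m) (Fin m) ℂ) (k : Fin m → Fin m) :
    Continuous (scaledBC C D k) := by
  refine continuous_matrix fun j s => ?_
  rcases s with s | s <;> simp only [scaledBC, Matrix.of_apply, Sum.elim_inl, Sum.elim_inr] <;>
    fun_prop

namespace IsNormalizedBC

variable {m : ℕ} {C D : Matrix (Fin m) (Fin m) ℂ} {k : Fin m → Fin m}

theorem zero_pow_mul_left (h : IsNormalizedBC C D k) (j s : Fin m) :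
    -- For `s > k j` the truncated exponent is `0` and the power is `1`; there the coefficient
    -- itself vanishes.
    ((0 : ℝ) : ℂ) ^ ((k j : ℕ) - (s : ℕ)) * C j s = if k j = s then C j s else 0 := by
  split_ifs with hs
  · simp [hs]
  · rcases lt_or_gt_of_ne hs with hlt | hgt
    · simp [(h.order_le j s hlt).1]
    · have : (k j : ℕ) - (s : ℕ) ≠ 0 := by
        have : (s : ℕ) < k j := hgt
        omega
      simp [this]

theorem zero_pow_mul_right (h : IsNormalizedBC C D k) (j s : Fin m) :
    ((0 : ℝ) : ℂ) ^ ((k j : ℕ) - (s : ℕ)) * D j s = if k j = s then D j s else 0 := by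
  split_ifs with hs
  · simp [hs]
  · rcases lt_or_gt_of_ne hs with hlt | hgt
    · simp [(h.order_le j s hlt).2]
    · have : (k j : ℕ) - (s : ℕ) ≠ 0 := by
        have : (s : ℕ) < k j := hgt
        omega
      simp [this]

theorem scaledBC_zero_mulVec (h : IsNormalizedBC C D k) (x : Fin m ⊕ Fin m → ℂ) (j : Fin m) :
    (scaledBC C D k 0).mulVec x j =
      C j (k j) * x (Sum.inl (k j)) + D j (k j) * x (Sum.inr (k j)) := by
  simp only [Matrix.mulVec, dotProduct, scaledBC, Matrix.of_apply, Fintype.sum_sum_type,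
    Sum.elim_inl, Sum.elim_inr, h.zero_pow_mul_left, h.zero_pow_mul_right]
  simp

/-- In the two columns of order `k i` only the rows of that same order are nonzero, so a relation
among all rows restricts to one among leading pairs of a single order. -/
theorem linearIndependent_scaledBC_zero (h : IsNormalizedBC C D k) :
    LinearIndependent ℂ (scaledBC C D k 0).row := by
  rw [Fintype.linearIndependent_iff]
  intro g hg i
  have hl := Fintype.linearIndependent_iff.1 (h.leading (k i)) (fun j => g j) ?_ ⟨i, rfl⟩
  · exact hl
  have hsub : ∀ f : Fin m → ℂ,
      ∑ j : {j // k j = k i}, f j = ∑ j, if k j = k i then f j else 0 := by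
    intro f
    rw [← Finset.sum_filter]
    exact (Finset.sum_subtype _ (by simp) f).symm
  funext e
  rw [Finset.sum_apply]
  fin_cases e
  · have h1 := congrFun hg (Sum.inl (k i))
    rw [Finset.sum_apply] at h1
    simp only [Pi.smul_apply, Matrix.row, scaledBC, Matrix.of_apply, Sum.elim_inl, smul_eq_mul,
      h.zero_pow_mul_left, mul_ite, mul_zero] at h1
    simpa using (hsub fun j => g j * C j (k i)).trans h1
  · have h1 := congrFun hg (Sum.inr (k i))
    rw [Finset.sum_apply] at h1
    simp only [Pi.smul_apply, Matrix.row, scaledBC, Matrix.of_apply, Sum.elim_inr, smul_eq_mul,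
      h.zero_pow_mul_right, mul_ite, mul_zero] at h1
    simpa using (hsub fun j => g j * D j (k i)).trans h1

theorem exists_scaledBC_zero_mul_eq_one (h : IsNormalizedBC C D k) :
    ∃ S : Matrix (Fin m ⊕ Fin m) (Fin m) ℂ, scaledBC C D k 0 * S = 1 := by
  rw [← Matrix.mulVec_surjective_iff_exists_right_inverse]
  have hr := h.linearIndependent_scaledBC_zero.rank_matrix
  rw [Matrix.rank] at hr
  have : LinearMap.range (scaledBC C D k 0).mulVecLin = ⊤ :=
    Submodule.eq_top_of_finrank_eq (by simpa using hr)
  exact LinearMap.range_eq_top.1 this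

/-- A vector of the kernel of `scaledBC C D k t` gives, after rescaling, one of the kernel of
the boundary conditions. -/
theorem mulVec_of_scaledBC_mulVec_eq_zero (h : IsNormalizedBC C D k) {t : ℝ}
    {x : Fin m ⊕ Fin m → ℂ} (hx : (scaledBC C D k t).mulVec x = 0) :
    C.mulVec (fun s => (t : ℂ) ^ (s.rev : ℕ) * x (Sum.inl s)) +
      D.mulVec (fun s => (t : ℂ) ^ (s.rev : ℕ) * x (Sum.inr s)) = 0 := by
  funext j
  have hj := congrFun hx j
  simp only [Matrix.mulVec, dotProduct, scaledBC, Matrix.of_apply, Fintype.sum_sum_type,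
    Sum.elim_inl, Sum.elim_inr, Pi.zero_apply] at hj
  simp only [Matrix.mulVec, dotProduct, Pi.add_apply, Pi.zero_apply]
  have hpow : ∀ s : Fin m, s ≤ k j →
      (t : ℂ) ^ (s.rev : ℕ) = (t : ℂ) ^ ((k j).rev : ℕ) * (t : ℂ) ^ ((k j : ℕ) - (s : ℕ)) := by
    intro s hs
    rw [← pow_add, Fin.val_rev, Fin.val_rev]
    congr 1
    have : (s : ℕ) ≤ k j := hs
    omega
  rw [← mul_zero ((t : ℂ) ^ ((k j).rev : ℕ)), ← hj, mul_add, Finset.mul_sum, Finset.mul_sum]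
  congr 1
  · refine Finset.sum_congr rfl fun s _ => ?_
    by_cases hs : s ≤ k j
    · rw [hpow s hs]
      ring
    · simp [(h.order_le j s (not_le.1 hs)).1]
  · refine Finset.sum_congr rfl fun s _ => ?_
    by_cases hs : s ≤ k j
    · rw [hpow s hs]
      ring
    · simp [(h.order_le j s (not_le.1 hs)).2]

/-- Nonnegativity of the boundary form passes from normalized conditions to their principal
parts. -/
theorem principal_nonneg (h : IsNormalizedBC C D k) {ε : ℝ}
    (hpos : ∀ u w : Fin m → ℂ, C.mulVec u + D.mulVec w = 0 →
      0 ≤ ε * ((concomitant w).im - (concomitant u).im))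
    (x : Fin m ⊕ Fin m → ℂ) (hx : (scaledBC C D k 0).mulVec x = 0) :
    0 ≤ ε * ((concomitant fun s => x (Sum.inr s)).im -
      (concomitant fun s => x (Sum.inl s)).im) := by
  obtain ⟨S, hS⟩ := h.exists_scaledBC_zero_mul_eq_one
  let P := scaledBC C D k
  -- This is `x - S (P S)⁻¹ P x` cleared of its denominator: it lies in the kernel of `P t` for
  -- every `t`, depends continuously on `t`, and equals `x` at `t = 0`, where `P S = 1`.
  let z : ℝ → Fin m ⊕ Fin m → ℂ := fun t =>
    (P t * S).det • x - S.mulVec ((P t * S).adjugate.mulVec ((P t).mulVec x))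
  have hz : ∀ t, (P t).mulVec (z t) = 0 := by
    intro t
    simp only [z]
    rw [Matrix.mulVec_sub, Matrix.mulVec_smul, Matrix.mulVec_mulVec, Matrix.mulVec_mulVec,
      Matrix.mul_adjugate, Matrix.smul_mulVec, Matrix.one_mulVec, sub_self]
  have hz0 : z 0 = x := by
    simp only [z, P]
    rw [hS, hx]
    simp
  have hP : Continuous P := continuous_scaledBC C D k
  have hPS : Continuous fun t => P t * S := hP.matrix_mul continuous_const
  have hzc : Continuous z :=
    (hPS.matrix_det.smul continuous_const).sub (continuous_const.matrix_mulVec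
      (hPS.matrix_adjugate.matrix_mulVec (hP.matrix_mulVec continuous_const)))
  let f : ℝ → ℝ := fun t => ε * ((concomitant fun s => z t (Sum.inr s)).im -
      (concomitant fun s => z t (Sum.inl s)).im)
  have hfc : Continuous f := by
    have h1 : Continuous fun t => concomitant fun s => z t (Sum.inr s) :=
      continuous_concomitant.comp (continuous_pi fun s => (continuous_apply _).comp hzc)
    have h2 : Continuous fun t => concomitant fun s => z t (Sum.inl s) :=
      continuous_concomitant.comp (continuous_pi fun s => (continuous_apply _).comp hzc)
    exact continuous_const.mul
      ((Complex.continuous_im.comp h1).sub (Complex.continuous_im.comp h2))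
  have hf : ∀ t, 0 < t → 0 ≤ f t := by
    intro t ht
    have h1 := hpos _ _ (h.mulVec_of_scaledBC_mulVec_eq_zero (hz t))
    rw [concomitant_smul_rev, concomitant_smul_rev, Complex.im_ofReal_mul, Complex.im_ofReal_mul,
      ← mul_sub, mul_left_comm] at h1
    exact nonneg_of_mul_nonneg_right h1 (pow_pos ht _)
  have h0 : 0 ≤ f 0 := ge_of_tendsto (hfc.continuousAt.tendsto.mono_left nhdsWithin_le_nhds)
    (eventually_nhdsWithin_of_forall (s := Ioi 0) fun t ht => hf t ht)
  simpa only [f, hz0] using h0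

end IsNormalizedBC

/-- The boundary form vanishes on the kernel of the principal parts of dissipative conditions. -/
theorem IsNormalizedBC.principal_eq {n : ℕ} {C D : Matrix (Fin (2 * n)) (Fin (2 * n)) ℂ}
    {k : Fin (2 * n) → Fin (2 * n)} (h : IsNormalizedBC C D k) {ε : ℝ} (hε : ε ≠ 0)
    (hpos : ∀ u w : Fin (2 * n) → ℂ, C.mulVec u + D.mulVec w = 0 →
      0 ≤ ε * ((concomitant w).im - (concomitant u).im))
    (u w : Fin (2 * n) → ℂ) (huw : ∀ j, C j (k j) * u (k j) + D j (k j) * w (k j) = 0) :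
    (concomitant w).im = (concomitant u).im := by
  have h1 := h.principal_nonneg hpos (Sum.elim u w) (funext fun j => by
    rw [h.scaledBC_zero_mulVec]
    exact huw j)
  have h2 := h.principal_nonneg hpos (Sum.elim
    (fun s => (if (s : ℕ) < n then 1 else -1) * u s)
    (fun s => (if (s : ℕ) < n then 1 else -1) * w s)) (funext fun j => by
    rw [h.scaledBC_zero_mulVec]
    simp only [Sum.elim_inl, Sum.elim_inr, Pi.zero_apply]
    linear_combination (if (k j : ℕ) < n then 1 else -1) * huw j)
  simp only [Sum.elim_inl, Sum.elim_inr, concomitant_flip, Complex.neg_im] at h1 h2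
  have h3 : ε * ((concomitant w).im - (concomitant u).im) = 0 := by linarith
  exact sub_eq_zero.1 ((mul_eq_zero.1 h3).resolve_left hε)

theorem EquivalentBC.mulVec_eq_zero {m : ℕ} {A B C D : Matrix (Fin m) (Fin m) ℂ}
    (h : EquivalentBC A B C D) {u w : Fin m → ℂ} (huw : C.mulVec u + D.mulVec w = 0) :
    A.mulVec u + B.mulVec w = 0 := by
  obtain ⟨G, hG, rfl, rfl⟩ := h
  apply Matrix.mulVec_injective_iff_isUnit.2 hG
  rw [Matrix.mulVec_add, Matrix.mulVec_mulVec, Matrix.mulVec_mulVec, huw, Matrix.mulVec_zero]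

/-! ### The ordered roots and the regularity determinant -/

namespace IsOrderedRoots

theorem injective {m : ℕ} {ω : Fin m → ℂ} (h : IsOrderedRoots m ω) : Function.Injective ω :=
  fun i j hij => h.2.injective (by simp only [hij])

/-- The `ω_l` are `2n` distinct roots of `z^(2n) = -1`, hence all of them, and an even power does
not see the sign. -/
theorem exists_eq_neg {n : ℕ} (hn : 0 < n) {ω : Fin (2 * n) → ℂ}
    (h : IsOrderedRoots (2 * n) ω) (l : Fin (2 * n)) : ∃ l', ω l' = -ω l := by
  classical
  have hm : 0 < 2 * n := by omega
  have hsub : Finset.univ.image ω ⊆ (Polynomial.nthRoots (2 * n) (-1 : ℂ)).toFinset := by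
    intro z hz
    obtain ⟨i, -, rfl⟩ := Finset.mem_image.1 hz
    rw [Multiset.mem_toFinset, Polynomial.mem_nthRoots hm]
    exact h.1 i
  have heq := Finset.eq_of_subset_of_card_le hsub (by
    rw [Finset.card_image_of_injective _ h.injective, Finset.card_univ, Fintype.card_fin]
    exact (Multiset.toFinset_card_le _).trans (Polynomial.card_nthRoots _ _))
  have hmem : -ω l ∈ (Polynomial.nthRoots (2 * n) (-1 : ℂ)).toFinset := by
    rw [Multiset.mem_toFinset, Polynomial.mem_nthRoots hm, (even_two_mul n).neg_pow]
    exact h.1 l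
  rw [← heq] at hmem
  obtain ⟨l', -, hl'⟩ := Finset.mem_image.1 hmem
  exact ⟨l', hl'⟩

/-- Negation permutes the roots and reverses their order, so it must act on the indices as
`Fin.rev`. It follows that the first `n` rotated roots lie in the left half-plane and the others in
the right one. -/
theorem re_rev {n : ℕ} (hn : 0 < n) {ω : Fin (2 * n) → ℂ} (h : IsOrderedRoots (2 * n) ω)
    (l : Fin (2 * n)) :
    (ω l.rev * Complex.exp (Complex.I * Real.pi / (2 * (2 * n : ℕ)))).re =
      -(ω l * Complex.exp (Complex.I * Real.pi / (2 * (2 * n : ℕ)))).re := by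
  have hmono := h.2
  set f : Fin (2 * n) → ℝ := fun l =>
    (ω l * Complex.exp (Complex.I * Real.pi / (2 * (2 * n : ℕ)))).re with hf
  choose σ hσ using h.exists_eq_neg hn
  have hfσ : ∀ l, f (σ l) = -f l := fun l => by simp only [hf, hσ, neg_mul, Complex.neg_re]
  have hg : StrictMono fun l => σ (Fin.rev l) := fun a b hab => by
    rw [← hmono.lt_iff_lt, hfσ, hfσ, neg_lt_neg_iff]
    exact hmono (Fin.rev_lt_rev.2 hab)
  have hid : (fun l => σ (Fin.rev l)) = id := by
    rw [← hg.range_inj strictMono_id, range_id]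
    -- A strictly monotone self-map is determined by its range, and an injective self-map of a
    -- finite set is onto.
    exact (Finite.injective_iff_surjective.1 hg.injective).range_eq
  have := congrFun hid l.rev
  simp only [Fin.rev_rev, id] at this
  change f l.rev = -f l
  rw [← this, hfσ]

theorem re_neg {n : ℕ} (hn : 0 < n) {ω : Fin (2 * n) → ℂ} (h : IsOrderedRoots (2 * n) ω)
    {l : Fin (2 * n)} (hl : (l : ℕ) < n) :
    (ω l * Complex.exp (Complex.I * Real.pi / (2 * (2 * n : ℕ)))).re < 0 := by
  have h1 : l < l.rev := by
    rw [Fin.lt_def, Fin.val_rev]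
    omega
  have h2 := h.2 h1
  simp only [h.re_rev hn] at h2
  linarith

theorem re_pos {n : ℕ} (hn : 0 < n) {ω : Fin (2 * n) → ℂ} (h : IsOrderedRoots (2 * n) ω)
    {l : Fin (2 * n)} (hl : ¬(l : ℕ) < n) :
    0 < (ω l * Complex.exp (Complex.I * Real.pi / (2 * (2 * n : ℕ)))).re := by
  have h1 : l.rev < l := by
    rw [Fin.lt_def, Fin.val_rev]
    omega
  have h2 := h.2 h1
  simp only [h.re_rev hn] at h2
  linarith

end IsOrderedRoots

theorem exp_I_pi_div_pow {m : ℕ} (hm : 0 < m) :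
    Complex.exp (Complex.I * Real.pi / (2 * m)) ^ m = Complex.I := by
  have hmC : (m : ℂ) ≠ 0 := by exact_mod_cast hm.ne'
  rw [← Complex.exp_nat_mul, show (m : ℂ) * (Complex.I * Real.pi / (2 * m)) =
    Real.pi / 2 * Complex.I by field_simp, Complex.exp_pi_div_two_mul_I]

/-- The coefficient `θ₋₁` is not zero if the boundary form vanishes on the kernel of the
principal parts. -/
theorem det_leading_ne_zero {n : ℕ} (hn : 0 < n) {α β : Fin (2 * n) → ℂ}
    {k : Fin (2 * n) → Fin (2 * n)} {ω : Fin (2 * n) → ℂ} (hω : IsOrderedRoots (2 * n) ω)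
    (h : ∀ u w : Fin (2 * n) → ℂ, (∀ j, α j * u (k j) + β j * w (k j) = 0) →
      (concomitant w).im = (concomitant u).im) :
    (Matrix.of fun j l : Fin (2 * n) =>
      (if (l : ℕ) < n then α j else β j) * ω l ^ (k j : ℕ)).det ≠ 0 := by
  intro hdet
  obtain ⟨c, hc0, hc⟩ := Matrix.exists_mulVec_eq_zero_iff.2 hdet
  let μ : ℂ := Complex.exp (Complex.I * Real.pi / (2 * (2 * n : ℕ)))
  have hμ : μ ≠ 0 := Complex.exp_ne_zero _
  let ζ : Fin (2 * n) → ℂ := fun l => ω l * μ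
  have hinj : Function.Injective ζ := fun i j hij => hω.injective (mul_right_cancel₀ hμ hij)
  have hpow : ∀ i, ζ i ^ (2 * n) = -Complex.I := fun i => by
    simp only [ζ, μ]
    rw [mul_pow, hω.1, exp_I_pi_div_pow (by omega), neg_one_mul]
  -- The null vector is split into its decaying part `a` and its growing part `b`; the rotation by
  -- `μ` multiplies row `j` only by `μ ^ k_j`.
  let a : Fin (2 * n) → ℂ := fun l => if (l : ℕ) < n then c l else 0
  let b : Fin (2 * n) → ℂ := fun l => if (l : ℕ) < n then 0 else c l
  have hker : ∀ j, α j * ∑ i, a i * ζ i ^ (k j : ℕ) + β j * ∑ i, b i * ζ i ^ (k j : ℕ) = 0 := by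
    intro j
    have hj := congrFun hc j
    simp only [Matrix.mulVec, dotProduct, Matrix.of_apply, Pi.zero_apply] at hj
    rw [← mul_zero (μ ^ (k j : ℕ)), ← hj, Finset.mul_sum, Finset.mul_sum, Finset.mul_sum,
      ← Finset.sum_add_distrib]
    refine Finset.sum_congr rfl fun i _ => ?_
    simp only [a, b, ζ]
    split_ifs <;> ring
  obtain ⟨ha, hb⟩ := eq_zero_of_concomitant_im_eq (even_two_mul n) (c := a) (d := b) hinj hpow
    (fun i hi => hω.re_neg hn (by
      by_contra hl
      exact hi (if_neg hl)))
    (fun i hi => hω.re_pos hn (fun hl => hi (if_pos hl)))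
    (h _ _ hker)
  apply hc0
  funext l
  by_cases hl : (l : ℕ) < n
  · simpa [a, hl] using congrFun ha l
  · simpa [b, hl] using congrFun hb l

/-- Only the columns `n - 1` and `n` (counted from `0`) contain `s`, and the determinant is linear
in each. The term in `1/s` takes `α` from the former and `β` from the latter. -/
theorem exists_regularityMatrix_det_expansion {n : ℕ} (hn : 0 < n) (α β : Fin (2 * n) → ℂ)
    (k : Fin (2 * n) → Fin (2 * n)) (ω : Fin (2 * n) → ℂ) :
    ∃ θzero θpos : ℂ, ∀ s : ℂ, s ≠ 0 →
      (Matrix.of fun j l : Fin (2 * n) =>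
        (if (l : ℕ) < n then α j else β j) * ω l ^ (k j : ℕ)).det / s + θzero + θpos * s =
      (regularityMatrix n α β k ω s).det := by
  let p : Fin (2 * n) := ⟨n - 1, by omega⟩
  let q : Fin (2 * n) := ⟨n, by omega⟩
  have hpq : p ≠ q := fun h => by
    have := congrArg Fin.val h
    simp only [p, q] at this
    omega
  -- The value `1` is arbitrary, as both columns depending on `s` get overwritten.
  let N := regularityMatrix n α β k ω 1
  let a : Fin (2 * n) → Fin (2 * n) → ℂ := fun l j => α j * ω l ^ (k j : ℕ)
  let b : Fin (2 * n) → Fin (2 * n) → ℂ := fun l j => β j * ω l ^ (k j : ℕ)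
  let d : (Fin (2 * n) → ℂ) → (Fin (2 * n) → ℂ) → ℂ := fun x y =>
    ((N.updateCol p x).updateCol q y).det
  have hadd_right : ∀ x y y' t, d x (y + t • y') = d x y + t * d x y' := fun x y y' t => by
    simp only [d]
    rw [Matrix.det_updateCol_add, Matrix.det_updateCol_smul]
  have hadd_left : ∀ x x' y t, d (x + t • x') y = d x y + t * d x' y := fun x x' y t => by
    simp only [d]
    rw [Matrix.updateCol_comm _ hpq, Matrix.updateCol_comm _ hpq, Matrix.updateCol_comm _ hpq,
      Matrix.det_updateCol_add, Matrix.det_updateCol_smul]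
  have hreg : ∀ s, regularityMatrix n α β k ω s =
      (N.updateCol p (a p + s • b p)).updateCol q (a q + (1 / s) • b q) := by
    intro s
    ext j l
    rw [Matrix.updateCol_apply, Matrix.updateCol_apply]
    split_ifs with h1 h2
    · subst h1
      simp [regularityMatrix, a, b, q]
      ring
    · subst h2
      have h3 : n - 1 + 1 = n := by omega
      simp [regularityMatrix, a, b, p, h3]
      ring
    · have h1' : (l : ℕ) ≠ n := fun h => h1 (Fin.ext h)
      have h2' : (l : ℕ) + 1 ≠ n := fun h => h2 (Fin.ext (by simp only [p]; omega))
      simp [N, regularityMatrix, h1', h2']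
  have hneg : (Matrix.of fun j l : Fin (2 * n) =>
      (if (l : ℕ) < n then α j else β j) * ω l ^ (k j : ℕ)) =
      (N.updateCol p (a p)).updateCol q (b q) := by
    ext j l
    rw [Matrix.updateCol_apply, Matrix.updateCol_apply]
    split_ifs with h1 h2
    · subst h1
      simp [b, q]
    · subst h2
      have h3 : n - 1 < n := by omega
      simp [a, p, h3]
    · have h1' : (l : ℕ) ≠ n := fun h => h1 (Fin.ext h)
      have h2' : (l : ℕ) + 1 ≠ n := fun h => h2 (Fin.ext (by simp only [p]; omega))
      have h3 : (l : ℕ) + 1 < n ↔ (l : ℕ) < n := by omega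
      simp [N, regularityMatrix, h1', h2', h3]
  refine ⟨d (a p) (a q) + d (b p) (b q), d (b p) (a q), fun s hs => ?_⟩
  rw [hreg, hneg]
  change d (a p) (b q) / s + _ + _ = d _ _
  rw [hadd_right, hadd_left, hadd_left]
  field_simp
  ring

/-! ### Existence of normalized conditions -/

theorem IndependentBC.eq_zero_of_vecMul_eq_zero {m : ℕ} {A B : Matrix (Fin m) (Fin m) ℂ}
    (h : IndependentBC A B) {g : Fin m → ℂ} (hA : Matrix.vecMul g A = 0)
    (hB : Matrix.vecMul g B = 0) : g = 0 := by
  funext i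
  refine Fintype.linearIndependent_iff.1 h g ?_ i
  funext s
  rw [Finset.sum_apply]
  rcases s with s | s
  · simpa [Matrix.vecMul, dotProduct] using congrFun hA s
  · simpa [Matrix.vecMul, dotProduct] using congrFun hB s

/-- An equivalent system, with a bound `k` on the orders, in which the leading coefficients of
each order are linearly independent: one for which the sum of the bounds is minimal. -/
theorem exists_leading_linearIndependent {m : ℕ} {A B : Matrix (Fin m) (Fin m) ℂ}
    (h : IndependentBC A B) :
    ∃ (G : Matrix (Fin m) (Fin m) ℂ) (k : Fin m → Fin m), IsUnit G ∧
      (∀ j s, k j < s → (G * A) j s = 0 ∧ (G * B) j s = 0) ∧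
      ∀ r : Fin m, LinearIndependent ℂ
        (fun j : {j : Fin m // k j = r} => ![(G * A) j r, (G * B) j r]) := by
  classical
  let T : Set (Matrix (Fin m) (Fin m) ℂ × (Fin m → Fin m)) :=
    {x | IsUnit x.1 ∧ ∀ j s, x.2 j < s → (x.1 * A) j s = 0 ∧ (x.1 * B) j s = 0}
  have hT : T.Nonempty := by
    refine ⟨(1, fun j => ⟨m - 1, by have := j.2; omega⟩), isUnit_one, fun j s hs => ?_⟩
    have := Fin.lt_def.1 hs
    simp only at this
    omega
  obtain ⟨⟨G, k⟩, ⟨hG, hk⟩, hmin⟩ := exists_minimalFor_of_wellFoundedLT (· ∈ T)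
    (fun x => ∑ j, (x.2 j : ℕ)) hT
  simp only at hG hk
  refine ⟨G, k, hG, hk, fun r => ?_⟩
  by_contra hdep
  obtain ⟨g, hg, ⟨j₀, hj₀⟩, hgne⟩ := Fintype.not_linearIndependent_iff.1 hdep
  let c : Fin m → ℂ := fun j => if hj : k j = r then g ⟨j, hj⟩ else 0
  have hc : ∀ j, k j ≠ r → c j = 0 := fun j hj => dif_neg hj
  have hc₀ : c j₀ ≠ 0 := by
    simpa only [c, dif_pos hj₀] using hgne
  have hsum : ∀ f : Fin m → ℂ, ∑ j, c j * f j = ∑ j : {j // k j = r}, g j * f j := by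
    intro f
    have h1 : ∑ j, c j * f j = ∑ j ∈ Finset.univ.filter (fun j => k j = r), c j * f j := by
      rw [Finset.sum_filter]
      refine Finset.sum_congr rfl fun j _ => ?_
      split_ifs with hj
      · rfl
      · rw [hc j hj, zero_mul]
    rw [h1, Finset.sum_subtype (p := fun j => k j = r) _ (by simp)]
    refine Finset.sum_congr rfl fun j _ => ?_
    simp only [c, dif_pos j.2]
  -- A dependence among the leading pairs of order `r` is used to eliminate that order from
  -- condition `j₀`; the determinant is only multiplied by `c j₀ ≠ 0`.
  let G' := G.updateRow j₀ (∑ j, c j • G j)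
  have hG' : IsUnit G' := by
    rw [Matrix.isUnit_iff_isUnit_det] at hG ⊢
    rw [Matrix.det_updateRow_sum, smul_eq_mul]
    exact (isUnit_iff_ne_zero.2 hc₀).mul hG
  have hrow : ∀ M : Matrix (Fin m) (Fin m) ℂ, ∀ s,
      (G' * M) j₀ s = ∑ j, c j * (G * M) j s := by
    intro M s
    simp only [G', Matrix.updateRow_mul, Matrix.updateRow_self, Matrix.sum_vecMul,
      Matrix.smul_vecMul, Finset.sum_apply, Pi.smul_apply, smul_eq_mul]
    rfl
  have hother : ∀ M : Matrix (Fin m) (Fin m) ℂ, ∀ j s, j ≠ j₀ → (G' * M) j s = (G * M) j s := by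
    intro M j s hj
    simp only [G', Matrix.updateRow_mul, Matrix.updateRow_ne hj]
  have hvanish : ∀ s, r ≤ s → (G' * A) j₀ s = 0 ∧ (G' * B) j₀ s = 0 := by
    intro s hs
    rw [hrow, hrow]
    rcases hs.eq_or_lt with rfl | hlt
    · rw [hsum fun j => (G * A) j r, hsum fun j => (G * B) j r]
      have h0 := congrFun hg 0
      have h1 := congrFun hg 1
      rw [Finset.sum_apply] at h0 h1
      exact ⟨by simpa using h0, by simpa using h1⟩
    · refine ⟨Finset.sum_eq_zero fun j _ => ?_, Finset.sum_eq_zero fun j _ => ?_⟩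
      · by_cases hj : k j = r
        · rw [(hk j s (hj ▸ hlt)).1, mul_zero]
        · rw [hc j hj, zero_mul]
      · by_cases hj : k j = r
        · rw [(hk j s (hj ▸ hlt)).2, mul_zero]
        · rw [hc j hj, zero_mul]
  -- For `r = 0` the new condition would be identically zero, against independence; otherwise its
  -- bound drops to `r - 1`, against minimality.
  by_cases hr : (r : ℕ) = 0
  · have hz : G' j₀ = 0 := h.eq_zero_of_vecMul_eq_zero
      (funext fun s => (hvanish s (by simp [Fin.le_def, hr])).1)
      (funext fun s => (hvanish s (by simp [Fin.le_def, hr])).2)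
    rw [Matrix.isUnit_iff_isUnit_det, Matrix.det_eq_zero_of_row_eq_zero j₀ (congrFun hz)] at hG'
    exact not_isUnit_zero hG'
  · let r' : Fin m := ⟨r - 1, by omega⟩
    have hmem : (G', Function.update k j₀ r') ∈ T := by
      refine ⟨hG', fun j s hs => ?_⟩
      simp only at hs ⊢
      by_cases hj : j = j₀
      · subst hj
        rw [Function.update_self] at hs
        refine hvanish s ?_
        have := Fin.lt_def.1 hs
        simp only [r'] at this
        rw [Fin.le_def]
        omega
      · rw [Function.update_of_ne hj] at hs
        rw [hother A j s hj, hother B j s hj]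
        exact hk j s hs
    have hlt : ∑ j, ((Function.update k j₀ r' j : Fin m) : ℕ) < ∑ j, (k j : ℕ) := by
      refine Finset.sum_lt_sum (fun j _ => ?_) ⟨j₀, Finset.mem_univ _, ?_⟩
      · by_cases hj : j = j₀
        · subst hj
          rw [Function.update_self, hj₀]
          simp [r']
        · rw [Function.update_of_ne hj]
      · rw [Function.update_self, hj₀]
        simp only [r']
        omega
    exact absurd (hmin hmem hlt.le) (not_le.2 hlt)

theorem IndependentBC.exists_isNormalizedBC {m : ℕ} {A B : Matrix (Fin m) (Fin m) ℂ}
    (h : IndependentBC A B) : ∃ C D k, EquivalentBC A B C D ∧ IsNormalizedBC C D k := by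
  obtain ⟨G, k, hG, hk, hl⟩ := exists_leading_linearIndependent h
  let σ : Equiv.Perm (Fin m) := Tuple.sort fun j => OrderDual.toDual (k j)
  have hσ : Antitone (k ∘ σ) := Tuple.monotone_sort fun j => OrderDual.toDual (k j)
  have hsub : ∀ M : Matrix (Fin m) (Fin m) ℂ, G.submatrix σ id * M = (G * M).submatrix σ id :=
    fun M => rfl
  refine ⟨(G * A).submatrix σ id, (G * B).submatrix σ id, k ∘ σ,
    ⟨G.submatrix σ id, ?_, (hsub A).symm, (hsub B).symm⟩, hσ, fun j s hs => hk (σ j) s hs,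
    fun r => ?_⟩
  · rw [Matrix.isUnit_iff_isUnit_det] at hG ⊢
    rw [Matrix.det_permute, isUnit_iff_ne_zero]
    rw [isUnit_iff_ne_zero] at hG
    refine mul_ne_zero ?_ hG
    rcases Int.units_eq_one_or (Equiv.Perm.sign σ) with h1 | h1 <;> simp [h1]
  · exact (hl r).comp (fun j : {j // (k ∘ σ) j = r} => (⟨σ j, j.2⟩ : {j // k j = r}))
      fun i j hij => Subtype.ext (σ.injective (congrArg Subtype.val hij))

theorem mainTheorem1 (n : ℕ) (hn : 0 < n) (A B : Matrix (Fin (2 * n)) (Fin (2 * n)) ℂ)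
    (hind : IndependentBC A B) (hdiss : IsDissipativeBC A B) :
    IsBirkhoffRegularBC n A B := by
  refine ⟨hind.exists_isNormalizedBC, fun C D k hequiv hnorm ω hω => ?_⟩
  have hzero := hnorm.principal_eq (pow_ne_zero n (by norm_num : (-1 : ℝ) ≠ 0)) fun u w huw =>
    hdiss.concomitant_nonneg u w (hequiv.mulVec_eq_zero huw)
  obtain ⟨θzero, θpos, hθ⟩ := exists_regularityMatrix_det_expansion hn
    (fun j => C j (k j)) (fun j => D j (k j)) k ω
  exact ⟨_, θzero, θpos, hθ, Or.inl (det_leading_ne_zero hn hω hzero)⟩
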